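/- Let $\mathbf{IPC}$ be intuitionistic propositional logic in the language $\{\bot,\wedge,\vee,\to\}$ over an arbitrary set of atoms (with $\top$ and $\neg\varphi$ abbreviating $\bot\to\bot$ and $\varphi\to\bot$), and write $\mathbf{IPC}\vdash\varphi$ if $\varphi$ is derivable without assumptions in intuitionistic natural deduction. A formula is called $p$-free if the atom $p$ does not occur in it. Then $\mathbf{IPC}$ has the uniform interpolation property: for every formula $\varphi$ and every atom $p$ there are two $p$-free formulas $\forall p\,\varphi$ and $\exists p\,\varphi$ such that 1. $\mathbf{IPC}\vdash \forall p\,\varphi\to\varphi$; 2. for every $p$-free formula $\psi$, if $\mathbf{IPC}\vdash\psi\to\varphi$ then $\mathbf{IPC}\vdash\psi\to\forall p\,\varphi$; 3. $\mathbf{IPC}\vdash\varphi\to\exists p\,\varphi$; 4. for every $p$-free formula $\psi$, if $\mathbf{IPC}\vdash\varphi\to\psi$ then $\mathbf{IPC}\vdash\exists p\,\varphi\to\psi$. -/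

import Mathlib

namespace IPC

/-- Propositional formulas over a type `α` of atoms, in the language `⊥, ∧, ∨, →`.
As usual, `⊤` is `⊥ → ⊥` and `¬ φ` is `φ → ⊥`. -/
inductive Formula (α : Type*) : Type _
  | atom (p : α) : Formula α
  | bot : Formula α
  | and (φ ψ : Formula α) : Formula α
  | or (φ ψ : Formula α) : Formula α
  | imp (φ ψ : Formula α) : Formula α

/-- The set `V(φ)` of atoms that occur in `φ`. -/
def Formula.vars {α : Type*} : Formula α → Set α
  | .atom p => {p}
  | .bot => ∅
  | .and φ ψ => φ.vars ∪ ψ.vars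
  | .or φ ψ => φ.vars ∪ ψ.vars
  | .imp φ ψ => φ.vars ∪ ψ.vars

/-- `φ` is `p`-free: the atom `p` does not occur in `φ`. -/
def Formula.Free {α : Type*} (p : α) (φ : Formula α) : Prop :=
  p ∉ φ.vars

/-- Natural deduction for intuitionistic propositional logic:
`Derives Γ φ` says that `φ` is derivable from the assumptions in `Γ`. -/
inductive Derives {α : Type*} : Set (Formula α) → Formula α → Prop
  | ax {Γ : Set (Formula α)} {φ : Formula α} : φ ∈ Γ → Derives Γ φ
  | botE {Γ : Set (Formula α)} {φ : Formula α} : Derives Γ .bot → Derives Γ φ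
  | andI {Γ : Set (Formula α)} {φ ψ : Formula α} :
      Derives Γ φ → Derives Γ ψ → Derives Γ (.and φ ψ)
  | andE₁ {Γ : Set (Formula α)} {φ ψ : Formula α} : Derives Γ (.and φ ψ) → Derives Γ φ
  | andE₂ {Γ : Set (Formula α)} {φ ψ : Formula α} : Derives Γ (.and φ ψ) → Derives Γ ψ
  | orI₁ {Γ : Set (Formula α)} {φ ψ : Formula α} : Derives Γ φ → Derives Γ (.or φ ψ)
  | orI₂ {Γ : Set (Formula α)} {φ ψ : Formula α} : Derives Γ ψ → Derives Γ (.or φ ψ)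
  | orE {Γ : Set (Formula α)} {φ ψ χ : Formula α} :
      Derives Γ (.or φ ψ) → Derives (insert φ Γ) χ → Derives (insert ψ Γ) χ → Derives Γ χ
  | impI {Γ : Set (Formula α)} {φ ψ : Formula α} :
      Derives (insert φ Γ) ψ → Derives Γ (.imp φ ψ)
  | impE {Γ : Set (Formula α)} {φ ψ : Formula α} :
      Derives Γ (.imp φ ψ) → Derives Γ φ → Derives Γ ψ

/-- The logic `IPC`, as the set of its theorems. -/
def logic (α : Type*) : Set (Formula α) :=
  {φ | Derives ∅ φ}

/-- A logic `L`, given by its set of theorems, has uniform interpolation: for every formula `φ` and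
atom `p` there are a `p`-free pre-interpolant `A` (that is, `∀p φ`) and a `p`-free post-interpolant
`E` (that is, `∃p φ`). -/
def HasUniformInterpolation {α : Type*} (L : Set (Formula α)) : Prop :=
  ∀ (φ : Formula α) (p : α), ∃ A E : Formula α,
    A.Free p ∧ E.Free p ∧
    Formula.imp A φ ∈ L ∧
    (∀ ψ : Formula α, ψ.Free p → Formula.imp ψ φ ∈ L → Formula.imp ψ A ∈ L) ∧
    Formula.imp φ E ∈ L ∧
    (∀ ψ : Formula α, ψ.Free p → Formula.imp φ ψ ∈ L → Formula.imp E ψ ∈ L)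

end IPC

namespace IPC

/-! This is Pitts's construction. Interpolants `E(Γ)` and `A(Γ; φ)` are built for finite contexts
and sequents by recursion along Dyckhoff's contraction-free rules, whose premises are all smaller
than their conclusion. `IsPost` and `IsPre` quantify over a `p`-free side context `Δ`, so that an
analysis of `Γ + Δ ⊢ φ` can proceed whichever half holds the principal formula.

No sequent calculus or cut elimination is set up. Invertible left rules become equivalences of
contexts, and disjunctions split a context in two (`reducible_or_irreducible`). When nothing
applies, `Irreducible.cases` finds a last rule; it is proved by gluing a new root below a family of
theories.

For irreducible `Γ`, the post-interpolant is a conjunction over the members of `Γ`: an atom `q ≠ p`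
contributes `q`, a member `q → b` contributes `q → E(b, Γ')`, and `(c → d) → b` contributes `A(c, d
→ b, Γ'; d) → E(b, Γ')`, with `Γ'` the remaining context. The pre-interpolant, for goals other than
conjunctions and implications, is `E(Γ) → D`, with `D` the analogous disjunction plus a disjunct for
the right rules. -/

variable {α : Type*}

/-! ### Structural properties of derivability and finite contexts -/

namespace Derives

theorem weaken {Γ Δ : Set (Formula α)} {φ : Formula α} (h : Derives Γ φ) (hs : Γ ⊆ Δ) :
    Derives Δ φ := by
  induction h generalizing Δ with
  | ax h => exact ax (hs h)
  | botE _ ih => exact botE (ih hs)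
  | andI _ _ ih₁ ih₂ => exact andI (ih₁ hs) (ih₂ hs)
  | andE₁ _ ih => exact andE₁ (ih hs)
  | andE₂ _ ih => exact andE₂ (ih hs)
  | orI₁ _ ih => exact orI₁ (ih hs)
  | orI₂ _ ih => exact orI₂ (ih hs)
  | orE _ _ _ ih ih₁ ih₂ =>
    exact orE (ih hs) (ih₁ (Set.insert_subset_insert hs)) (ih₂ (Set.insert_subset_insert hs))
  | impI _ ih => exact impI (ih (Set.insert_subset_insert hs))
  | impE _ _ ih₁ ih₂ => exact impE (ih₁ hs) (ih₂ hs)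

theorem subst {Γ Δ : Set (Formula α)} {φ : Formula α} (h : Derives Γ φ)
    (hs : ∀ x ∈ Γ, Derives Δ x) : Derives Δ φ := by
  have lift : ∀ {Γ Δ : Set (Formula α)} (a : Formula α), (∀ x ∈ Γ, Derives Δ x) →
      ∀ x ∈ insert a Γ, Derives (insert a Δ) x := by
    rintro Γ Δ a h x (rfl | hx)
    · exact ax (Set.mem_insert _ _)
    · exact (h x hx).weaken (Set.subset_insert _ _)
  induction h generalizing Δ with
  | ax h => exact hs _ h
  | botE _ ih => exact botE (ih hs)
  | andI _ _ ih₁ ih₂ => exact andI (ih₁ hs) (ih₂ hs)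
  | andE₁ _ ih => exact andE₁ (ih hs)
  | andE₂ _ ih => exact andE₂ (ih hs)
  | orI₁ _ ih => exact orI₁ (ih hs)
  | orI₂ _ ih => exact orI₂ (ih hs)
  | orE _ _ _ ih ih₁ ih₂ => exact orE (ih hs) (ih₁ (lift _ hs)) (ih₂ (lift _ hs))
  | impI _ ih => exact impI (ih (lift _ hs))
  | impE _ _ ih₁ ih₂ => exact impE (ih₁ hs) (ih₂ hs)

end Derives

/-- Derivability from a finite multiset of assumptions. -/
def Prov (Γ : Multiset (Formula α)) (φ : Formula α) : Prop :=
  Derives {x | x ∈ Γ} φ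

namespace Prov

variable {Γ Δ : Multiset (Formula α)} {φ ψ χ : Formula α}

theorem setOf_mem_cons (a : Formula α) (Γ : Multiset (Formula α)) :
    {x | x ∈ a ::ₘ Γ} = insert a {x | x ∈ Γ} := by
  ext x; simp

theorem ax (h : φ ∈ Γ) : Prov Γ φ := Derives.ax h

theorem head : Prov (φ ::ₘ Γ) φ := ax (Multiset.mem_cons_self _ _)

theorem trans (h : Prov Γ φ) (hs : ∀ x ∈ Γ, Prov Δ x) : Prov Δ φ := Derives.subst h hs

theorem mono (h : Prov Γ φ) (hs : Γ ⊆ Δ) : Prov Δ φ := Derives.weaken h fun _ hx => hs hx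

theorem cons (h : Prov Γ φ) : Prov (ψ ::ₘ Γ) φ := h.mono (Multiset.subset_cons _ _)

theorem impI (h : Prov (φ ::ₘ Γ) ψ) : Prov Γ (.imp φ ψ) :=
  Derives.impI (by rwa [Prov, setOf_mem_cons] at h)

theorem impE (h : Prov Γ (.imp φ ψ)) (h' : Prov Γ φ) : Prov Γ ψ := Derives.impE h h'

theorem imp_iff : Prov Γ (.imp φ ψ) ↔ Prov (φ ::ₘ Γ) ψ :=
  ⟨fun h => h.cons.impE head, impI⟩

theorem botE (h : Prov Γ .bot) : Prov Γ φ := Derives.botE h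

theorem andI (h : Prov Γ φ) (h' : Prov Γ ψ) : Prov Γ (.and φ ψ) := Derives.andI h h'

theorem left (h : Prov Γ (.and φ ψ)) : Prov Γ φ := Derives.andE₁ h

theorem right (h : Prov Γ (.and φ ψ)) : Prov Γ ψ := Derives.andE₂ h

theorem inl (h : Prov Γ φ) : Prov Γ (.or φ ψ) := Derives.orI₁ h

theorem inr (h : Prov Γ ψ) : Prov Γ (.or φ ψ) := Derives.orI₂ h

theorem orE (h : Prov Γ (.or φ ψ)) (h₁ : Prov (φ ::ₘ Γ) χ) (h₂ : Prov (ψ ::ₘ Γ) χ) :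
    Prov Γ χ :=
  Derives.orE h (by rwa [Prov, setOf_mem_cons] at h₁) (by rwa [Prov, setOf_mem_cons] at h₂)

theorem cut (h : Prov Γ φ) (h' : Prov (φ ::ₘ Γ) ψ) : Prov Γ ψ := h'.impI.impE h

theorem cons_of_cons (h : Prov (φ ::ₘ Γ) χ) (hψ : Prov (ψ ::ₘ Γ) φ) : Prov (ψ ::ₘ Γ) χ :=
  hψ.cut (h.mono (Multiset.cons_subset_cons (Multiset.subset_cons _ _)))

theorem congr_add {Γ' : Multiset (Formula α)} (h : ∀ x ∈ Γ, Prov Γ' x)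
    (hp : Prov (Γ + Δ) φ) : Prov (Γ' + Δ) φ := by
  refine hp.trans fun x hx => ?_
  rcases Multiset.mem_add.1 hx with hx | hx
  · exact (h x hx).mono (Multiset.subset_of_le (Multiset.le_add_right _ _))
  · exact ax (Multiset.mem_add.2 (.inr hx))

theorem congr_add_right {Δ' : Multiset (Formula α)} (h : ∀ x ∈ Δ, Prov Δ' x)
    (hp : Prov (Γ + Δ) φ) : Prov (Γ + Δ') φ := by
  rw [add_comm] at hp ⊢
  exact congr_add h hp

theorem congr_cons {Γ' : Multiset (Formula α)} (h : ∀ x ∈ Γ, Prov Γ' x)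
    (hp : Prov (ψ ::ₘ Γ) φ) : Prov (ψ ::ₘ Γ') φ := by
  rw [← Multiset.singleton_add] at hp ⊢
  exact congr_add_right h hp

end Prov

/-! ### A measure that decreases along the contraction-free rules -/

/-- The weight of a formula. -/
def Formula.weight : Formula α → ℕ
  | .atom _ => 1
  | .bot => 1
  -- The extra unit makes `(a ∧ b) → c` heavier than `a → (b → c)`.
  | .and φ ψ => φ.weight + ψ.weight + 2
  | .or φ ψ => φ.weight + ψ.weight + 1
  | .imp φ ψ => φ.weight + ψ.weight + 1

/-- The contribution of a formula to the measure of a sequent. -/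
def Formula.size (φ : Formula α) : ℕ := 4 ^ φ.weight

theorem Formula.size_pos (φ : Formula α) : 0 < φ.size := by unfold Formula.size; positivity

/-- Base 4 lets one formula be traded for three lighter ones with a strict drop of the sum. Three is
the worst case: `c`, `d → b` and the new goal `d` in the left rule for `(c → d) → b`. -/
theorem Formula.four_mul_size_le {φ ψ : Formula α} (h : φ.weight < ψ.weight) :
    4 * φ.size ≤ ψ.size := by
  unfold Formula.size
  rw [← pow_succ']
  exact Nat.pow_le_pow_right (by norm_num) h

/-- The measure of a multiset of formulas. -/
def measure (Γ : Multiset (Formula α)) : ℕ := (Γ.map Formula.size).sum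

@[simp]
theorem measure_cons (φ : Formula α) (Γ : Multiset (Formula α)) :
    measure (φ ::ₘ Γ) = φ.size + measure Γ := by
  simp [measure]

section Weights

variable (a b c : Formula α)

theorem size_and_left : 4 * a.size ≤ (a.and b).size :=
  Formula.four_mul_size_le (by simp only [Formula.weight]; omega)

theorem size_and_right : 4 * b.size ≤ (a.and b).size :=
  Formula.four_mul_size_le (by simp only [Formula.weight]; omega)

theorem size_or_left : 4 * a.size ≤ (a.or b).size :=
  Formula.four_mul_size_le (by simp only [Formula.weight]; omega)

theorem size_or_right : 4 * b.size ≤ (a.or b).size :=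
  Formula.four_mul_size_le (by simp only [Formula.weight]; omega)

theorem size_imp_left : 4 * a.size ≤ (a.imp b).size :=
  Formula.four_mul_size_le (by simp only [Formula.weight]; omega)

theorem size_imp_right : 4 * b.size ≤ (a.imp b).size :=
  Formula.four_mul_size_le (by simp only [Formula.weight]; omega)

theorem size_and_imp : 4 * (a.imp (b.imp c)).size ≤ ((a.and b).imp c).size :=
  Formula.four_mul_size_le (by simp only [Formula.weight]; omega)

theorem size_or_imp_left : 4 * (a.imp c).size ≤ ((a.or b).imp c).size :=
  Formula.four_mul_size_le (by
    have : 0 < b.weight := by cases b <;> simp [Formula.weight]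
    simp only [Formula.weight]; omega)

theorem size_or_imp_right : 4 * (b.imp c).size ≤ ((a.or b).imp c).size :=
  Formula.four_mul_size_le (by
    have : 0 < a.weight := by cases a <;> simp [Formula.weight]
    simp only [Formula.weight]; omega)

theorem size_imp_imp_left : 4 * a.size ≤ ((a.imp b).imp c).size :=
  Formula.four_mul_size_le (by simp only [Formula.weight]; omega)

theorem size_imp_imp_middle : 4 * b.size ≤ ((a.imp b).imp c).size :=
  Formula.four_mul_size_le (by simp only [Formula.weight]; omega)

theorem size_imp_imp_right : 4 * (b.imp c).size ≤ ((a.imp b).imp c).size :=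
  Formula.four_mul_size_le (by
    simp only [Formula.weight]; omega)

end Weights

section FreeLemmas

variable {p : α} {a b : Formula α}

@[simp]
theorem free_atom {q : α} : (Formula.atom q).Free p ↔ p ≠ q := by
  simp [Formula.Free, Formula.vars]

@[simp]
theorem free_bot : (Formula.bot : Formula α).Free p := by simp [Formula.Free, Formula.vars]

@[simp]
theorem free_and : (a.and b).Free p ↔ a.Free p ∧ b.Free p := by
  simp [Formula.Free, Formula.vars]

@[simp]
theorem free_or : (a.or b).Free p ↔ a.Free p ∧ b.Free p := by
  simp [Formula.Free, Formula.vars]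

@[simp]
theorem free_imp : (a.imp b).Free p ↔ a.Free p ∧ b.Free p := by
  simp [Formula.Free, Formula.vars]

end FreeLemmas

/-! ### Invertible left rules and irreducible contexts -/

/-- A context to which no invertible left rule of the terminating sequent calculus applies. -/
def Irreducible (Γ : Multiset (Formula α)) : Prop :=
  ∀ x ∈ Γ, (∃ q, x = .atom q) ∨ (∃ q b, x = .imp (.atom q) b ∧ .atom q ∉ Γ) ∨
    ∃ c d b, x = .imp (.imp c d) b

/-- `Γ'` is an equivalent context of smaller measure, with no new atoms. -/
def ReducesTo (Γ Γ' : Multiset (Formula α)) : Prop :=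
  measure Γ' < measure Γ ∧ (∀ x ∈ Γ, Prov Γ' x) ∧ (∀ x ∈ Γ', Prov Γ x) ∧
    ∀ p : α, (∀ x ∈ Γ, x.Free p) → ∀ x ∈ Γ', x.Free p

theorem ReducesTo.of_cons {a : Formula α} {Γ Δ : Multiset (Formula α)}
    (hm : measure Δ < a.size) (h : Prov (Δ + Γ) a) (h' : ∀ x ∈ Δ, Prov (a ::ₘ Γ) x)
    (hf : ∀ p, a.Free p → ∀ x ∈ Δ, x.Free p) : ReducesTo (a ::ₘ Γ) (Δ + Γ) := by
  refine ⟨?_, ?_, ?_, ?_⟩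
  · simp only [measure, Multiset.map_add, Multiset.map_cons, Multiset.sum_cons,
      Multiset.sum_add] at hm ⊢
    omega
  · intro x hx
    rcases Multiset.mem_cons.1 hx with rfl | hx
    · exact h
    · exact .ax (by simp [hx])
  · intro x hx
    rcases Multiset.mem_add.1 hx with hx | hx
    · exact h' x hx
    · exact .ax (by simp [hx])
  · intro p hp x hx
    rcases Multiset.mem_add.1 hx with hx | hx
    · exact hf p (hp a (by simp)) x hx
    · exact hp x (by simp [hx])

/-- Each formula shape excluded by irreducibility has an invertible left rule. Disjunction is kept
apart because it has two premises, so no single context replaces it. -/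
theorem reducible_or_irreducible (Γ : Multiset (Formula α)) :
    .bot ∈ Γ ∨ (∃ a b Γ', Γ = .or a b ::ₘ Γ') ∨ (∃ Γ', ReducesTo Γ Γ') ∨ Irreducible Γ := by
  by_contra! hcon
  obtain ⟨h₀, h₁, h₂, h₃⟩ := hcon
  apply h₃
  intro x hx
  obtain ⟨Γ', rfl⟩ := Multiset.exists_cons_of_mem hx
  rcases x with q | _ | ⟨a, b⟩ | ⟨a, b⟩ | ⟨a, b⟩
  · exact .inl ⟨q, rfl⟩
  · exact absurd hx h₀
  · refine absurd (ReducesTo.of_cons (Δ := {a, b}) ?_ ?_ ?_ ?_) (h₂ _)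
    · have := size_and_left a b
      have := size_and_right a b
      have := a.size_pos
      simp [measure]; omega
    · exact .andI (.ax (by simp)) (.ax (by simp))
    · simp only [Multiset.insert_eq_cons, Multiset.mem_cons, Multiset.mem_singleton]
      rintro x (rfl | rfl)
      · exact Prov.head.left
      · exact Prov.head.right
    · simp
  · exact absurd rfl (h₁ a b Γ')
  · rcases a with q | _ | ⟨c, d⟩ | ⟨c, d⟩ | ⟨c, d⟩
    · by_cases hq : .atom q ∈ Γ'
      · refine absurd (ReducesTo.of_cons (Δ := {b}) ?_ ?_ ?_ ?_) (h₂ _)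
        · have := size_imp_right (.atom q) b
          have := b.size_pos
          simp [measure]; omega
        · exact .impI (.ax (by simp))
        · simp only [Multiset.mem_singleton]
          rintro x rfl
          exact Prov.head.impE (.ax (by simp [hq]))
        · simp
      · exact .inr (.inl ⟨q, b, rfl, by simp [hq]⟩)
    · refine absurd (ReducesTo.of_cons (Δ := 0) ?_ ?_ ?_ ?_) (h₂ _)
      · simpa [measure] using Formula.size_pos _
      · exact .impI Prov.head.botE
      · simp
      · simp
    · refine absurd (ReducesTo.of_cons (Δ := {.imp c (.imp d b)}) ?_ ?_ ?_ ?_) (h₂ _)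
      · have := size_and_imp c d b
        have := (c.imp (d.imp b)).size_pos
        simp [measure]; omega
      · exact .impI (.impE (.impE (φ := c) (.ax (by simp)) Prov.head.left) Prov.head.right)
      · simp only [Multiset.mem_singleton]
        rintro x rfl
        exact .impI (.impI (.impE (φ := c.and d) (.ax (by simp))
          (.andI (.ax (by simp)) (.ax (by simp)))))
      · simp; tauto
    · refine absurd (ReducesTo.of_cons (Δ := {.imp c b, .imp d b}) ?_ ?_ ?_ ?_) (h₂ _)
      · have := size_or_imp_left c d b
        have := size_or_imp_right c d b
        have := (c.imp b).size_pos
        simp [measure]; omega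
      · exact .impI (.orE Prov.head (.impE (φ := c) (.ax (by simp)) Prov.head)
          (.impE (φ := d) (.ax (by simp)) Prov.head))
      · simp only [Multiset.insert_eq_cons, Multiset.mem_cons, Multiset.mem_singleton]
        rintro x (rfl | rfl)
        · exact .impI (.impE (φ := c.or d) (.ax (by simp)) Prov.head.inl)
        · exact .impI (.impE (φ := c.or d) (.ax (by simp)) Prov.head.inr)
      · simp; tauto
    · exact .inr (.inr ⟨c, d, b, rfl⟩)

/-! ### The last rule of a derivation from an irreducible context -/

/-- Forcing at a new root below the theories in `T`, where the atoms in `P` hold at the root. -/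
def RootForces (T : Set (Multiset (Formula α))) (P : Set α) : Formula α → Prop
  | .atom q => q ∈ P
  | .bot => False
  | .and a b => RootForces T P a ∧ RootForces T P b
  | .or a b => RootForces T P a ∨ RootForces T P b
  | .imp a b => (∀ Θ ∈ T, Prov Θ (.imp a b)) ∧ (RootForces T P a → RootForces T P b)

/-- Persistence from the root to the theories above it; the implication clause has it built in. -/
theorem RootForces.prov {T : Set (Multiset (Formula α))} {P : Set α}
    (hP : ∀ q ∈ P, ∀ Θ ∈ T, Prov Θ (.atom q)) {φ : Formula α} (h : RootForces T P φ) :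
    ∀ Θ ∈ T, Prov Θ φ := by
  intro Θ hΘ
  induction φ with
  | atom q => exact hP q h Θ hΘ
  | bot => exact h.elim
  | and a b iha ihb => exact .andI (iha h.1) (ihb h.2)
  | or a b iha ihb => exact h.elim (fun h => (iha h).inl) (fun h => (ihb h).inr)
  | imp a b _ _ => exact h.1 Θ hΘ

theorem RootForces.sound {T : Set (Multiset (Formula α))} {P : Set α}
    (hP : ∀ q ∈ P, ∀ Θ ∈ T, Prov Θ (.atom q)) {Γ : Set (Formula α)} {φ : Formula α}
    (h : Derives Γ φ) (hΓ : ∀ x ∈ Γ, RootForces T P x) : RootForces T P φ := by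
  have insert : ∀ {Γ : Set (Formula α)} {a}, (∀ x ∈ Γ, RootForces T P x) → RootForces T P a →
      ∀ x ∈ insert a Γ, RootForces T P x := by
    rintro Γ a h ha x (rfl | hx)
    exacts [ha, h x hx]
  induction h with
  | ax h => exact hΓ _ h
  | botE _ ih => exact (ih hΓ).elim
  | andI _ _ ih₁ ih₂ => exact ⟨ih₁ hΓ, ih₂ hΓ⟩
  | andE₁ _ ih => exact (ih hΓ).1
  | andE₂ _ ih => exact (ih hΓ).2
  | orI₁ _ ih => exact .inl (ih hΓ)
  | orI₂ _ ih => exact .inr (ih hΓ)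
  | orE _ _ _ ih ih₁ ih₂ =>
    exact (ih hΓ).elim (fun h => ih₁ (insert hΓ h)) (fun h => ih₂ (insert hΓ h))
  | impI h ih =>
    exact ⟨fun Θ hΘ => Derives.subst (Derives.impI h) fun x hx => (hΓ x hx).prov hP Θ hΘ,
      fun h => ih (insert hΓ h)⟩
  | impE _ _ ih₁ ih₂ => exact (ih₁ hΓ).2 (ih₂ hΓ)

/-- How a formula can be derivable from an irreducible context. -/
theorem Irreducible.cases {Γ : Multiset (Formula α)} (hΓ : Irreducible Γ) {φ : Formula α}
    (h : Prov Γ φ) :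
    (∃ a b, φ = .and a b) ∨ (∃ a b, φ = .imp a b) ∨ (∃ q, φ = .atom q ∧ φ ∈ Γ) ∨
    (∃ a b, φ = .or a b ∧ (Prov Γ a ∨ Prov Γ b)) ∨
    ∃ c d b Γ', Γ = .imp (.imp c d) b ::ₘ Γ' ∧ Prov (c ::ₘ .imp d b ::ₘ Γ') d := by
  by_contra! hcon
  obtain ⟨h₁, h₂, h₃, h₄, h₅⟩ := hcon
  -- Besides `Γ`, the root sees the left premise of the rule for each `(c → d) → b` in `Γ`. By `h₅`
  -- none of these premises derives its `d`, so the root does not force `c → d` and forces the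
  -- member of `Γ` vacuously.
  let T : Set (Multiset (Formula α)) := {Θ | Θ = Γ ∨ ∃ c d b Γ',
    Γ = .imp (.imp c d) b ::ₘ Γ' ∧ Θ = c ::ₘ .imp d b ::ₘ Γ'}
  let P : Set α := {q | .atom q ∈ Γ}
  have hT : ∀ x ∈ Γ, ∀ Θ ∈ T, Prov Θ x := by
    rintro x hx Θ (rfl | ⟨c, d, b, Γ', rfl, rfl⟩)
    · exact .ax hx
    · rcases Multiset.mem_cons.1 hx with rfl | hx
      · exact .impI (.impE (φ := d) (.ax (by simp)) (Prov.head.impE (.ax (by simp))))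
      · exact .ax (by simp [hx])
  have hP : ∀ q ∈ P, ∀ Θ ∈ T, Prov Θ (.atom q) := fun q hq => hT _ hq
  have hforces : ∀ x ∈ Γ, RootForces T P x := by
    intro x hx
    rcases hΓ x hx with ⟨q, rfl⟩ | ⟨q, b, rfl, hq⟩ | ⟨c, d, b, rfl⟩
    · exact hx
    · exact ⟨hT _ hx, fun h => absurd h hq⟩
    · refine ⟨hT _ hx, fun h => ?_⟩
      obtain ⟨Γ', hΓ'⟩ := Multiset.exists_cons_of_mem hx
      refine absurd ?_ (h₅ c d b Γ' hΓ')
      exact (h.1 _ (.inr ⟨c, d, b, Γ', hΓ', rfl⟩)).impE Prov.head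
  have hφ := RootForces.sound hP h hforces
  rcases φ with q | _ | ⟨a, b⟩ | ⟨a, b⟩ | ⟨a, b⟩
  · exact h₃ q rfl hφ
  · exact hφ
  · exact h₁ a b rfl
  · rcases hφ with hφ | hφ
    · exact (h₄ a b rfl).1 (hφ.prov hP Γ (.inl rfl))
    · exact (h₄ a b rfl).2 (hφ.prov hP Γ (.inl rfl))
  · exact h₂ a b rfl

/-! ### Interpolants relative to a side context -/

/-- `e` is the strongest `p`-free consequence of `Γ`. -/
def IsPost (p : α) (Γ : Multiset (Formula α)) (e : Formula α) : Prop :=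
  e.Free p ∧ Prov Γ e ∧ ∀ Δ : Multiset (Formula α), (∀ x ∈ Δ, x.Free p) →
    ∀ ψ : Formula α, ψ.Free p → Prov (Γ + Δ) ψ → Prov (e ::ₘ Δ) ψ

/-- `a` is the weakest `p`-free formula that together with `Γ` implies `φ`. -/
def IsPre (p : α) (Γ : Multiset (Formula α)) (φ a : Formula α) : Prop :=
  a.Free p ∧ Prov (a ::ₘ Γ) φ ∧ ∀ Δ : Multiset (Formula α), (∀ x ∈ Δ, x.Free p) →
    Prov (Γ + Δ) φ → Prov Δ a

section Interpolants

variable {p : α} {Γ Γ' Δ : Multiset (Formula α)} {φ : Formula α}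

theorem ReducesTo.isPost (h : ReducesTo Γ Γ') {e : Formula α} (he : IsPost p Γ' e) :
    IsPost p Γ e :=
  ⟨he.1, he.2.1.trans h.2.2.1, fun Δ hΔ ψ hψ hp => he.2.2 Δ hΔ ψ hψ (hp.congr_add h.2.1)⟩

theorem ReducesTo.isPre (h : ReducesTo Γ Γ') {a : Formula α} (ha : IsPre p Γ' φ a) :
    IsPre p Γ φ a :=
  ⟨ha.1, ha.2.1.congr_cons h.2.2.1, fun Δ hΔ hp => ha.2.2 Δ hΔ (hp.congr_add h.2.1)⟩

theorem isPost_bot (h : .bot ∈ Γ) : IsPost p Γ .bot :=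
  ⟨free_bot, .ax h, fun _ _ _ _ _ => Prov.head.botE⟩

theorem isPre_bot (h : .bot ∈ Γ) : IsPre p Γ φ (.imp .bot .bot) :=
  ⟨by simp, Prov.botE (.ax (by simp [h])), fun _ _ _ => .impI .head⟩

theorem prov_of_or_cons {a b : Formula α} (h : Prov (.or a b ::ₘ Γ + Δ) φ) :
    Prov (a ::ₘ Γ + Δ) φ ∧ Prov (b ::ₘ Γ + Δ) φ := by
  rw [Multiset.cons_add] at h ⊢
  rw [Multiset.cons_add]
  exact ⟨h.cons_of_cons Prov.head.inl, h.cons_of_cons Prov.head.inr⟩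

theorem isPost_or {a b e₁ e₂ : Formula α} (h₁ : IsPost p (a ::ₘ Γ) e₁)
    (h₂ : IsPost p (b ::ₘ Γ) e₂) : IsPost p (.or a b ::ₘ Γ) (.or e₁ e₂) := by
  refine ⟨free_or.2 ⟨h₁.1, h₂.1⟩, ?_, fun Δ hΔ ψ hψ h => ?_⟩
  · exact Prov.head.orE (h₁.2.1.inl.congr_cons fun _ hx => .cons (.ax hx))
      (h₂.2.1.inr.congr_cons fun _ hx => .cons (.ax hx))
  · exact Prov.head.orE
      ((h₁.2.2 Δ hΔ ψ hψ (prov_of_or_cons h).1).congr_cons fun _ hx => .cons (.ax hx))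
      ((h₂.2.2 Δ hΔ ψ hψ (prov_of_or_cons h).2).congr_cons fun _ hx => .cons (.ax hx))

theorem isPre_or {a b c₁ c₂ : Formula α} (h₁ : IsPre p (a ::ₘ Γ) φ c₁)
    (h₂ : IsPre p (b ::ₘ Γ) φ c₂) : IsPre p (.or a b ::ₘ Γ) φ (.and c₁ c₂) := by
  refine ⟨free_and.2 ⟨h₁.1, h₂.1⟩, ?_, fun Δ hΔ h => ?_⟩
  · refine Prov.orE (φ := a) (ψ := b) (.ax (by simp)) (h₁.2.1.trans ?_) (h₂.2.1.trans ?_)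
    all_goals
      intro x hx
      simp only [Multiset.mem_cons] at hx
      rcases hx with rfl | rfl | hx
    · exact .cons (Prov.head.left)
    · exact .head
    · exact .ax (by simp [hx])
    · exact .cons (Prov.head.right)
    · exact .head
    · exact .ax (by simp [hx])
  · exact .andI (h₁.2.2 Δ hΔ (prov_of_or_cons h).1) (h₂.2.2 Δ hΔ (prov_of_or_cons h).2)

theorem isPre_and {a b c₁ c₂ : Formula α} (h₁ : IsPre p Γ a c₁) (h₂ : IsPre p Γ b c₂) :
    IsPre p Γ (.and a b) (.and c₁ c₂) :=
  ⟨free_and.2 ⟨h₁.1, h₂.1⟩,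
    .andI (h₁.2.1.cons_of_cons Prov.head.left) (h₂.2.1.cons_of_cons Prov.head.right),
    fun Δ hΔ h => .andI (h₁.2.2 Δ hΔ h.left) (h₂.2.2 Δ hΔ h.right)⟩

theorem isPre_imp {a b c : Formula α} (h : IsPre p (a ::ₘ Γ) b c) : IsPre p Γ (.imp a b) c :=
  ⟨h.1, .impI (by rw [Multiset.cons_swap]; exact h.2.1),
    fun Δ hΔ hp => h.2.2 Δ hΔ (by rw [Multiset.cons_add]; exact Prov.imp_iff.1 hp)⟩

/-- Conjunction of formulas chosen for the members of a context. -/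
theorem exists_conj (Q : Formula α → Formula α → Prop)
    (hQ : ∀ x e e', Q x e → Prov {e'} e → Q x e') (Θ : Multiset (Formula α))
    (h : ∀ x ∈ Θ, ∃ e : Formula α, e.Free p ∧ Prov Γ e ∧ Q x e) :
    ∃ e : Formula α, e.Free p ∧ Prov Γ e ∧ ∀ x ∈ Θ, Q x e := by
  induction Θ using Multiset.induction_on with
  | empty => exact ⟨.imp .bot .bot, by simp, .impI .head, by simp⟩
  | cons x Θ ih =>
    obtain ⟨e, he, hΓe, hq⟩ := ih fun y hy => h y (by simp [hy])
    obtain ⟨e', he', hΓe', hq'⟩ := h x (by simp)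
    refine ⟨.and e' e, by simp [he, he'], .andI hΓe' hΓe, fun y hy => ?_⟩
    rcases Multiset.mem_cons.1 hy with rfl | hy
    · exact hQ _ _ _ hq' (Prov.left (ψ := e) (.ax (by simp)))
    · exact hQ _ _ _ (hq y hy) (Prov.right (φ := e') (.ax (by simp)))

/-- Disjunction of formulas chosen for the members of a context. -/
theorem exists_disj (Q : Formula α → Formula α → Prop)
    (hQ : ∀ x e e', Q x e → Prov {e} e' → Q x e') (Θ : Multiset (Formula α))
    (h : ∀ x ∈ Θ, ∃ e : Formula α, e.Free p ∧ Prov (e ::ₘ Γ) φ ∧ Q x e) :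
    ∃ e : Formula α, e.Free p ∧ Prov (e ::ₘ Γ) φ ∧ ∀ x ∈ Θ, Q x e := by
  induction Θ using Multiset.induction_on with
  | empty => exact ⟨.bot, by simp, Prov.head.botE, by simp⟩
  | cons x Θ ih =>
    obtain ⟨e, he, hΓe, hq⟩ := ih fun y hy => h y (by simp [hy])
    obtain ⟨e', he', hΓe', hq'⟩ := h x (by simp)
    refine ⟨.or e' e, by simp [he, he'], ?_, fun y hy => ?_⟩
    · exact Prov.head.orE (hΓe'.congr_cons fun _ hx => .cons (.ax hx))
        (hΓe.congr_cons fun _ hx => .cons (.ax hx))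
    rcases Multiset.mem_cons.1 hy with rfl | hy
    · exact hQ _ _ _ hq' (Prov.inl (.ax (by simp)))
    · exact hQ _ _ _ (hq y hy) (Prov.inr (.ax (by simp)))

/-- Since `(c → d) → b` yields `d → b`, the hypothesis gives `c → d`, and hence `b`. -/
theorem prov_imp_imp_cons {c d b a : Formula α} (ha : Prov (a ::ₘ c ::ₘ .imp d b ::ₘ Γ) d) :
    ∀ x ∈ b ::ₘ Γ, Prov (a ::ₘ .imp (.imp c d) b ::ₘ Γ) x := by
  intro x hx
  rcases Multiset.mem_cons.1 hx with rfl | hx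
  · refine Prov.impE (φ := .imp c d) (.ax (by simp)) (.impI (ha.trans fun y hy => ?_))
    simp only [Multiset.mem_cons] at hy
    rcases hy with rfl | rfl | rfl | hy
    · exact .ax (by simp)
    · exact .head
    · exact .impI (.impE (φ := .imp c d) (.ax (by simp)) (.impI (.ax (by simp))))
    · exact .ax (by simp [hy])
  · exact .ax (by simp [hx])

theorem prov_atom_imp_cons {q : α} {b : Formula α} :
    ∀ x ∈ b ::ₘ Γ, Prov (.atom q ::ₘ .imp (.atom q) b ::ₘ Γ) x := by
  intro x hx
  rcases Multiset.mem_cons.1 hx with rfl | hx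
  · exact .impE (φ := .atom q) (.ax (by simp)) .head
  · exact .ax (by simp [hx])

/-- Replacing an implication by its conclusion is sound. -/
theorem prov_cons_of_imp {a b : Formula α} (h : Prov (.imp a b ::ₘ Γ) φ) : Prov (b ::ₘ Γ) φ :=
  h.cons_of_cons (.impI (.cons .head))

/-- Reduction of the `p`-free part of a context whose other part is irreducible. -/
theorem reduce_free_part {e χ : Formula α} (hΓ : Irreducible Γ)
    (he : ∀ q, p ≠ q → .atom q ∈ Γ → Prov {e} (.atom q)) (hΔ : ∀ x ∈ Δ, x.Free p)
    (ih : ∀ Δ' : Multiset (Formula α), (∀ x ∈ Δ', x.Free p) → measure Δ' < measure Δ →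
      Prov (Γ + Δ') φ → Prov (e ::ₘ Δ') χ)
    (h : Prov (Γ + Δ) φ) :
    Prov (e ::ₘ Δ) χ ∨ Irreducible (Γ + Δ) ∨
      ∃ q b Γ', Γ = .imp (.atom q) b ::ₘ Γ' ∧ .atom q ∈ Δ := by
  rcases reducible_or_irreducible Δ with hb | ⟨a, b, Δ', rfl⟩ | ⟨Δ', hr⟩ | hirr
  · exact .inl (Prov.botE (.ax (by simp [hb])))
  · left
    have hf := free_or.1 (hΔ (.or a b) (by simp))
    have hΔ' : ∀ x ∈ Δ', x.Free p := fun x hx => hΔ x (by simp [hx])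
    have hl := size_or_left a b
    have hr := size_or_right a b
    have hs := a.size_pos
    have hs' := b.size_pos
    rw [Multiset.add_cons] at h
    have h₁ := ih (a ::ₘ Δ') (by simpa [hf.1] using hΔ') (by simp; omega)
      (by rw [Multiset.add_cons]; exact h.cons_of_cons Prov.head.inl)
    have h₂ := ih (b ::ₘ Δ') (by simpa [hf.2] using hΔ') (by simp; omega)
      (by rw [Multiset.add_cons]; exact h.cons_of_cons Prov.head.inr)
    refine Prov.orE (φ := a) (ψ := b) (.ax (by simp)) (h₁.mono ?_) (h₂.mono ?_) <;>
    · intro x hx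
      simp only [Multiset.mem_cons] at hx ⊢
      tauto
  · left
    exact (ih Δ' (hr.2.2.2 p hΔ) hr.1 (h.congr_add_right hr.2.1)).congr_cons hr.2.2.1
  · by_cases hc₁ : ∃ q b Γ', Γ = .imp (.atom q) b ::ₘ Γ' ∧ .atom q ∈ Δ
    · exact .inr (.inr hc₁)
    by_cases hc₂ : ∃ q b, .imp (.atom q) b ∈ Δ ∧ .atom q ∈ Γ
    -- Here `Γ` supplies the atom firing an implication of `Δ`. The atom occurs in `Δ`, so it
    -- differs from `p`, and `e` can supply it in place of `Γ`.
    · obtain ⟨q, b, hqb, hq⟩ := hc₂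
      obtain ⟨Δ', rfl⟩ := Multiset.exists_cons_of_mem hqb
      left
      have hf := free_imp.1 (hΔ _ hqb)
      have hΔ' : ∀ x ∈ Δ', x.Free p := fun x hx => hΔ x (by simp [hx])
      have hl := size_imp_right (.atom q) b
      have hs := b.size_pos
      rw [Multiset.add_cons] at h
      have h₁ := ih (b ::ₘ Δ') (by simpa [hf.2] using hΔ') (by simp; omega)
        (by rw [Multiset.add_cons]; exact prov_cons_of_imp h)
      refine h₁.trans fun x hx => ?_
      simp only [Multiset.mem_cons] at hx
      rcases hx with rfl | rfl | hx
      · exact .head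
      · refine Prov.impE (φ := .atom q) (.ax (by simp)) ?_
        exact (he q (free_atom.1 hf.1) hq).mono (by simp)
      · exact .ax (by simp [hx])
    · right; left
      intro x hx
      rcases Multiset.mem_add.1 hx with hx | hx
      · rcases hΓ x hx with h | ⟨q, b, rfl, hq⟩ | h
        · exact .inl h
        · refine .inr (.inl ⟨q, b, rfl, fun hm => ?_⟩)
          obtain ⟨Γ', rfl⟩ := Multiset.exists_cons_of_mem hx
          rcases Multiset.mem_add.1 hm with hm | hm
          · exact hq hm
          · exact hc₁ ⟨q, b, Γ', rfl, hm⟩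
        · exact .inr (.inr h)
      · rcases hirr x hx with h | ⟨q, b, rfl, hq⟩ | h
        · exact .inl h
        · refine .inr (.inl ⟨q, b, rfl, fun hm => ?_⟩)
          rcases Multiset.mem_add.1 hm with hm | hm
          · exact hc₂ ⟨q, b, hx, hm⟩
          · exact hq hm
        · exact .inr (.inr h)

/-! ### Post-interpolants -/

/-- What the conjunct of a post-interpolant of `Γ` that belongs to `x ∈ Γ` has to satisfy. -/
def PostConjunct (p : α) (Γ : Multiset (Formula α)) (x e : Formula α) : Prop :=
  (∀ q, x = .atom q → p ≠ q → Prov {e} (.atom q)) ∧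
  (∀ q b Γ', x = .imp (.atom q) b → Γ = x ::ₘ Γ' → ∀ Δ : Multiset (Formula α),
    (∀ y ∈ Δ, y.Free p) → .atom q ∈ Δ → ∀ ψ : Formula α, ψ.Free p →
    Prov (b ::ₘ Γ' + Δ) ψ → Prov (e ::ₘ Δ) ψ) ∧
  (∀ c d b Γ', x = .imp (.imp c d) b → Γ = x ::ₘ Γ' → ∀ Δ : Multiset (Formula α),
    (∀ y ∈ Δ, y.Free p) → ∀ ψ : Formula α, ψ.Free p →
    Prov (c ::ₘ .imp d b ::ₘ Γ' + Δ) d → Prov (b ::ₘ Γ' + Δ) ψ → Prov (e ::ₘ Δ) ψ)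

theorem PostConjunct.of_prov {x e e' : Formula α} (h : PostConjunct p Γ x e)
    (he : Prov {e'} e) : PostConjunct p Γ x e' := by
  have key : ∀ {Δ : Multiset (Formula α)} {ψ}, Prov (e ::ₘ Δ) ψ → Prov (e' ::ₘ Δ) ψ :=
    fun h => h.cons_of_cons (he.mono (by simp))
  exact ⟨fun q hx hq => key (Δ := 0) (h.1 q hx hq),
    fun q b Γ' hx hΓ Δ hΔ hq ψ hψ hp => key (h.2.1 q b Γ' hx hΓ Δ hΔ hq ψ hψ hp),
    fun c d b Γ' hx hΓ Δ hΔ ψ hψ hp hp' => key (h.2.2 c d b Γ' hx hΓ Δ hΔ ψ hψ hp hp')⟩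

theorem measure_lt_of_imp {a b : Formula α} :
    measure (b ::ₘ Γ) < measure (.imp a b ::ₘ Γ) := by
  have := size_imp_right a b
  have := b.size_pos
  simp; omega

theorem measure_lt_of_imp_imp {c d b : Formula α} :
    measure (c ::ₘ .imp d b ::ₘ Γ) + d.size < measure (.imp (.imp c d) b ::ₘ Γ) := by
  have := size_imp_imp_left c d b
  have := size_imp_imp_middle c d b
  have := size_imp_imp_right c d b
  have := c.size_pos
  simp; omega

theorem exists_postConjunct (hΓ : Irreducible Γ)
    (ihE : ∀ Γ' : Multiset (Formula α), measure Γ' < measure Γ → ∃ e, IsPost p Γ' e)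
    (ihA : ∀ (Γ' : Multiset (Formula α)) φ, measure Γ' + φ.size < measure Γ →
      ∃ a, IsPre p Γ' φ a) {x : Formula α} (hx : x ∈ Γ) :
    ∃ e : Formula α, e.Free p ∧ Prov Γ e ∧ PostConjunct p Γ x e := by
  rcases hΓ x hx with ⟨q, rfl⟩ | ⟨q, b, rfl, -⟩ | ⟨c, d, b, rfl⟩
  · by_cases hq : p = q
    · exact ⟨.imp .bot .bot, by simp, .impI .head, by simp [PostConjunct, hq]⟩
    · exact ⟨.atom q, by simpa using hq, .ax hx, by
        refine ⟨?_, by simp, by simp⟩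
        rintro _ h -
        rw [← h]
        exact .ax (by simp)⟩
  · obtain ⟨Γ', rfl⟩ := Multiset.exists_cons_of_mem hx
    by_cases hq : p = q
    -- A trivial conjunct suffices: a `p`-free `Δ` never contains `p`, so it cannot fire `p → b`.
    · refine ⟨.imp .bot .bot, by simp, .impI .head, by simp, ?_, by simp⟩
      rintro q' b' Γ'' h - Δ hΔ hm
      cases h
      exact absurd hq (free_atom.1 (hΔ _ hm))
    · obtain ⟨e, he, hΓe, hmax⟩ := ihE (b ::ₘ Γ') measure_lt_of_imp
      refine ⟨.imp (.atom q) e, by simp [hq, he], .impI (hΓe.trans prov_atom_imp_cons),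
        by simp, ?_, by simp⟩
      rintro q' b' Γ'' h h' Δ hΔ hm ψ hψ hp
      cases h
      obtain rfl := (Multiset.cons_inj_right _).1 h'
      exact (hmax Δ hΔ ψ hψ hp).cons_of_cons (Prov.head.impE (.ax (by simp [hm])))
  · obtain ⟨Γ', rfl⟩ := Multiset.exists_cons_of_mem hx
    obtain ⟨e, he, hΓe, hmax⟩ := ihE (b ::ₘ Γ') measure_lt_of_imp
    obtain ⟨a, ha, hΓa, hmin⟩ := ihA (c ::ₘ .imp d b ::ₘ Γ') d measure_lt_of_imp_imp
    refine ⟨.imp a e, by simp [ha, he], .impI (hΓe.trans (prov_imp_imp_cons hΓa)),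
      by simp, by simp, ?_⟩
    rintro c' d' b' Γ'' h h' Δ hΔ ψ hψ hp hp'
    cases h
    obtain rfl := (Multiset.cons_inj_right _).1 h'
    exact (hmax Δ hΔ ψ hψ hp').cons_of_cons (Prov.head.impE (hmin Δ hΔ hp).cons)

theorem prov_imp_imp_right {e c d b χ : Formula α} (h₁ : Prov (e ::ₘ c ::ₘ .imp d b ::ₘ Δ) d)
    (h₂ : Prov (e ::ₘ b ::ₘ Δ) χ) : Prov (e ::ₘ .imp (.imp c d) b ::ₘ Δ) χ := by
  refine h₂.trans fun x hx => ?_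
  rcases Multiset.mem_cons.1 hx with rfl | hx
  · exact .head
  · exact prov_imp_imp_cons h₁ x hx

/-- Induction on the size of `Δ` together with the goal, following the last rule over `Γ + Δ`. A
principal formula in `Γ` is handled by its conjunct; one in `Δ`, or a right rule, leads to smaller
`p`-free data over the same `Γ`. -/
theorem isPost_of_postConjunct (hΓ : Irreducible Γ) {e : Formula α} (he : e.Free p)
    (hΓe : Prov Γ e) (hc : ∀ x ∈ Γ, PostConjunct p Γ x e) : IsPost p Γ e := by
  refine ⟨he, hΓe, ?_⟩
  suffices H : ∀ n, ∀ (Δ : Multiset (Formula α)) (ψ : Formula α), measure Δ + ψ.size = n →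
      (∀ x ∈ Δ, x.Free p) → ψ.Free p → Prov (Γ + Δ) ψ → Prov (e ::ₘ Δ) ψ from
    fun Δ hΔ ψ hψ h => H _ Δ ψ rfl hΔ hψ h
  intro n
  induction n using Nat.strong_induction_on with
  | _ n ih =>
  intro Δ ψ hn hΔ hψ h
  replace ih : ∀ (Δ' : Multiset (Formula α)) (ψ' : Formula α),
      measure Δ' + ψ'.size < measure Δ + ψ.size →
      (∀ x ∈ Δ', x.Free p) → ψ'.Free p → Prov (Γ + Δ') ψ' → Prov (e ::ₘ Δ') ψ' :=
    fun Δ' ψ' hlt => ih _ (hn ▸ hlt) Δ' ψ' rfl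
  rcases reduce_free_part (χ := ψ) hΓ (fun q hq hm => (hc _ hm).1 q rfl hq) hΔ
    (fun Δ' hΔ' hlt hp => ih Δ' ψ (by omega) hΔ' hψ hp) h with h' | hirr | ⟨q, b, Γ', hΓ', hq⟩
  · exact h'
  · rcases hirr.cases h with ⟨a, b, rfl⟩ | ⟨a, b, rfl⟩ | ⟨q, rfl, hq⟩ | ⟨a, b, rfl, hab⟩ |
      ⟨c, d, b, Θ, hΘ, hd⟩
    · have := size_and_left a b
      have := size_and_right a b
      have := a.size_pos
      have := b.size_pos
      have hf := free_and.1 hψ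
      exact .andI (ih Δ a (by omega) hΔ hf.1 h.left) (ih Δ b (by omega) hΔ hf.2 h.right)
    · have := size_imp_left a b
      have := size_imp_right a b
      have := a.size_pos
      have hf := free_imp.1 hψ
      refine .impI ?_
      rw [Multiset.cons_swap]
      exact ih (a ::ₘ Δ) b (by simp; omega) (by simpa [hf.1] using hΔ) hf.2
        (by rw [Multiset.add_cons]; exact Prov.imp_iff.1 h)
    · rcases Multiset.mem_add.1 hq with hq | hq
      · exact ((hc _ hq).1 q rfl (free_atom.1 hψ)).mono (by simp)
      · exact .ax (by simp [hq])
    · have := size_or_left a b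
      have := size_or_right a b
      have := a.size_pos
      have := b.size_pos
      have hf := free_or.1 hψ
      exact hab.elim (fun h => (ih Δ a (by omega) hΔ hf.1 h).inl)
        fun h => (ih Δ b (by omega) hΔ hf.2 h).inr
    · have hmem : .imp (.imp c d) b ∈ Γ + Δ := by rw [hΘ]; simp
      rcases Multiset.mem_add.1 hmem with hm | hm
      · obtain ⟨Γ', hΓ'⟩ := Multiset.exists_cons_of_mem hm
        have hΘ' : Θ = Γ' + Δ := by
          rw [hΓ', Multiset.cons_add] at hΘ
          exact ((Multiset.cons_inj_right _).1 hΘ).symm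
        refine (hc _ hm).2.2 c d b Γ' rfl hΓ' Δ hΔ ψ hψ ?_ ?_
        · rwa [Multiset.cons_add, Multiset.cons_add, ← hΘ']
        -- `Irreducible.cases` gives only the left premise; the right one follows because `b`
        -- implies `(c → d) → b`.
        · rw [hΓ', Multiset.cons_add] at h
          rw [Multiset.cons_add]
          exact prov_cons_of_imp h
      · obtain ⟨Δ', rfl⟩ := Multiset.exists_cons_of_mem hm
        have hΘ' : Θ = Γ + Δ' := by
          rw [Multiset.add_cons] at hΘ
          exact ((Multiset.cons_inj_right _).1 hΘ).symm
        have hf := hΔ _ hm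
        simp only [free_imp] at hf
        have hΔ' : ∀ x ∈ Δ', x.Free p := fun x hx => hΔ x (by simp [hx])
        refine prov_imp_imp_right (ih _ d ?_ ?_ hf.1.2 ?_) (ih _ ψ ?_ ?_ hψ ?_)
        · have := measure_lt_of_imp_imp (Γ := Δ') (c := c) (d := d) (b := b)
          omega
        · simpa [hf] using hΔ'
        · rwa [Multiset.add_cons, Multiset.add_cons, ← hΘ']
        · have := measure_lt_of_imp (Γ := Δ') (a := c.imp d) (b := b)
          omega
        · simpa [hf] using hΔ'
        · rw [Multiset.add_cons] at h ⊢
          exact prov_cons_of_imp h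
  · refine (hc (.imp (.atom q) b) (by rw [hΓ']; simp)).2.1 q b Γ' rfl hΓ' Δ hΔ hq ψ hψ ?_
    rw [hΓ', Multiset.cons_add] at h
    rw [Multiset.cons_add]
    exact prov_cons_of_imp h

theorem exists_isPost
    (ihE : ∀ Γ' : Multiset (Formula α), measure Γ' < measure Γ → ∃ e, IsPost p Γ' e)
    (ihA : ∀ (Γ' : Multiset (Formula α)) φ, measure Γ' + φ.size < measure Γ →
      ∃ a, IsPre p Γ' φ a) : ∃ e, IsPost p Γ e := by
  rcases reducible_or_irreducible Γ with hb | ⟨a, b, Γ', rfl⟩ | ⟨Γ', hr⟩ | hΓ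
  · exact ⟨_, isPost_bot hb⟩
  · have := size_or_left a b
    have := size_or_right a b
    have := a.size_pos
    have := b.size_pos
    obtain ⟨e₁, h₁⟩ := ihE (a ::ₘ Γ') (by simp; omega)
    obtain ⟨e₂, h₂⟩ := ihE (b ::ₘ Γ') (by simp; omega)
    exact ⟨_, isPost_or h₁ h₂⟩
  · obtain ⟨e, he⟩ := ihE Γ' hr.1
    exact ⟨e, hr.isPost he⟩
  · obtain ⟨e, he, hΓe, hc⟩ := exists_conj (PostConjunct p Γ) (fun _ _ _ => .of_prov) Γ
      fun x hx => exists_postConjunct hΓ ihE ihA hx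
    exact ⟨e, isPost_of_postConjunct hΓ he hΓe hc⟩

/-! ### Pre-interpolants -/

/-- What the disjunct of a pre-interpolant of `φ` over `Γ` that belongs to `x ∈ Γ` has to
satisfy. -/
def PreDisjunct (p : α) (Γ : Multiset (Formula α)) (φ x a : Formula α) : Prop :=
  (∀ q, x = .atom q → φ = x → Prov 0 a) ∧
  (∀ q b Γ', x = .imp (.atom q) b → Γ = x ::ₘ Γ' → ∀ Δ : Multiset (Formula α),
    (∀ y ∈ Δ, y.Free p) → .atom q ∈ Δ → Prov (b ::ₘ Γ' + Δ) φ → Prov Δ a) ∧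
  (∀ c d b Γ', x = .imp (.imp c d) b → Γ = x ::ₘ Γ' → ∀ Δ : Multiset (Formula α),
    (∀ y ∈ Δ, y.Free p) → Prov (c ::ₘ .imp d b ::ₘ Γ' + Δ) d →
    Prov (b ::ₘ Γ' + Δ) φ → Prov Δ a)

theorem PreDisjunct.of_prov {x a a' : Formula α} (h : PreDisjunct p Γ φ x a)
    (ha : Prov {a} a') : PreDisjunct p Γ φ x a' := by
  have key : ∀ {Δ : Multiset (Formula α)}, Prov Δ a → Prov Δ a' :=
    fun h => h.cut (ha.mono (by simp))
  exact ⟨fun q hx hq => key (h.1 q hx hq),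
    fun q b Γ' hx hΓ Δ hΔ hq hp => key (h.2.1 q b Γ' hx hΓ Δ hΔ hq hp),
    fun c d b Γ' hx hΓ Δ hΔ hp hp' => key (h.2.2 c d b Γ' hx hΓ Δ hΔ hp hp')⟩

theorem exists_preDisjunct (hΓ : Irreducible Γ)
    (ihA : ∀ (Γ' : Multiset (Formula α)) ψ, measure Γ' + ψ.size < measure Γ + φ.size →
      ∃ a, IsPre p Γ' ψ a) {x : Formula α} (hx : x ∈ Γ) :
    ∃ a : Formula α, a.Free p ∧ Prov (a ::ₘ Γ) φ ∧ PreDisjunct p Γ φ x a := by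
  rcases hΓ x hx with ⟨q, rfl⟩ | ⟨q, b, rfl, -⟩ | ⟨c, d, b, rfl⟩
  · by_cases hq : φ = .atom q
    · exact ⟨.imp .bot .bot, by simp, .ax (by simp [hq, hx]),
        fun _ _ _ => .impI .head, by simp, by simp⟩
    · exact ⟨.bot, by simp, Prov.head.botE, by simp [PreDisjunct, hq]⟩
  · obtain ⟨Γ', rfl⟩ := Multiset.exists_cons_of_mem hx
    by_cases hq : p = q
    -- As a disjunct, `⊥` is neutral: `p → b` is never fired by a `p`-free `Δ`.
    · refine ⟨.bot, by simp, Prov.head.botE, by simp, ?_, by simp⟩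
      rintro q' b' Γ'' h - Δ hΔ hm
      cases h
      exact absurd hq (free_atom.1 (hΔ _ hm))
    · obtain ⟨a, ha, hΓa, hmin⟩ := ihA (b ::ₘ Γ') φ (by
        have := measure_lt_of_imp (Γ := Γ') (a := .atom q) (b := b)
        omega)
      refine ⟨.and (.atom q) a, by simp [hq, ha], ?_, by simp, ?_, by simp⟩
      · refine hΓa.trans fun x hx => ?_
        rcases Multiset.mem_cons.1 hx with rfl | hx
        · exact Prov.head.right
        · exact (prov_atom_imp_cons (q := q) x hx).cons_of_cons Prov.head.left
      · rintro q' b' Γ'' h h' Δ hΔ hm hp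
        cases h
        obtain rfl := (Multiset.cons_inj_right _).1 h'
        exact .andI (.ax hm) (hmin Δ hΔ hp)
  · obtain ⟨Γ', rfl⟩ := Multiset.exists_cons_of_mem hx
    obtain ⟨a₂, ha₂, hΓa₂, hmin₂⟩ := ihA (b ::ₘ Γ') φ (by
      have := measure_lt_of_imp (Γ := Γ') (a := .imp c d) (b := b)
      omega)
    obtain ⟨a₁, ha₁, hΓa₁, hmin₁⟩ := ihA (c ::ₘ .imp d b ::ₘ Γ') d (by
      have := measure_lt_of_imp_imp (Γ := Γ') (c := c) (d := d) (b := b)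
      omega)
    refine ⟨.and a₁ a₂, by simp [ha₁, ha₂], ?_, by simp, by simp, ?_⟩
    · refine hΓa₂.trans fun x hx => ?_
      rcases Multiset.mem_cons.1 hx with rfl | hx
      · exact Prov.head.right
      · exact (prov_imp_imp_cons hΓa₁ x hx).cons_of_cons Prov.head.left
    · rintro c' d' b' Γ'' h h' Δ hΔ hp hp'
      cases h
      obtain rfl := (Multiset.cons_inj_right _).1 h'
      exact .andI (hmin₁ Δ hΔ hp) (hmin₂ Δ hΔ hp')

/-- The disjunct of a pre-interpolant that belongs to the right rules for `φ`. -/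
theorem exists_goal_disjunct
    (ihA : ∀ (Γ' : Multiset (Formula α)) ψ, measure Γ' + ψ.size < measure Γ + φ.size →
      ∃ a, IsPre p Γ' ψ a) :
    ∃ a : Formula α, a.Free p ∧ Prov (a ::ₘ Γ) φ ∧ ∀ Δ : Multiset (Formula α),
      (∀ x ∈ Δ, x.Free p) → (∀ q, φ = .atom q → φ ∈ Δ → Prov Δ a) ∧
      (∀ b c, φ = .or b c → Prov (Γ + Δ) b ∨ Prov (Γ + Δ) c → Prov Δ a) := by
  rcases φ with q | _ | ⟨a, b⟩ | ⟨a, b⟩ | ⟨a, b⟩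
  · by_cases hq : p = q
    · refine ⟨.bot, by simp, Prov.head.botE, fun Δ hΔ => ⟨?_, by simp⟩⟩
      intro _ _ hm
      exact absurd hq (free_atom.1 (hΔ _ hm))
    · exact ⟨.atom q, by simpa using hq, .head, fun Δ hΔ => ⟨fun _ _ => .ax, by simp⟩⟩
  · exact ⟨.bot, by simp, .head, by simp⟩
  · exact ⟨.bot, by simp, Prov.head.botE, by simp⟩
  · have := size_or_left a b
    have := size_or_right a b
    have := a.size_pos
    have := b.size_pos
    obtain ⟨a₁, ha₁, hΓa₁, hmin₁⟩ := ihA Γ a (by omega)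
    obtain ⟨a₂, ha₂, hΓa₂, hmin₂⟩ := ihA Γ b (by omega)
    refine ⟨.or a₁ a₂, by simp [ha₁, ha₂], ?_, fun Δ hΔ => ⟨by simp, ?_⟩⟩
    · exact Prov.head.orE (hΓa₁.inl.congr_cons fun _ hx => .cons (.ax hx))
        (hΓa₂.inr.congr_cons fun _ hx => .cons (.ax hx))
    · rintro _ _ h hp
      cases h
      exact hp.elim (fun h => (hmin₁ Δ hΔ h).inl) fun h => (hmin₂ Δ hΔ h).inr
  · exact ⟨.bot, by simp, Prov.head.botE, by simp⟩

/-- The premise `e` stands in for `Γ` when an implication of `Δ` is principal and what must be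
derived to use it is `p`-free. The goal `φ` need not be `p`-free and stays fixed, so the induction
is on `Δ` alone. -/
theorem isPre_of_preDisjunct (hΓ : Irreducible Γ) {e a : Formula α} (he : IsPost p Γ e)
    (hand : ∀ b c, φ ≠ .and b c) (himp : ∀ b c, φ ≠ .imp b c)
    (ha : a.Free p) (hΓa : Prov (a ::ₘ Γ) φ) (hc : ∀ x ∈ Γ, PreDisjunct p Γ φ x a)
    (hφ : ∀ Δ : Multiset (Formula α), (∀ x ∈ Δ, x.Free p) →
      (∀ q, φ = .atom q → φ ∈ Δ → Prov Δ a) ∧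
      (∀ b c, φ = .or b c → Prov (Γ + Δ) b ∨ Prov (Γ + Δ) c → Prov Δ a)) :
    IsPre p Γ φ (.imp e a) := by
  refine ⟨by simp [he.1, ha], hΓa.cons_of_cons (Prov.head.impE he.2.1.cons), ?_⟩
  suffices H : ∀ n, ∀ Δ : Multiset (Formula α), measure Δ = n →
      (∀ x ∈ Δ, x.Free p) → Prov (Γ + Δ) φ → Prov (e ::ₘ Δ) a from
    fun Δ hΔ h => .impI (H _ Δ rfl hΔ h)
  intro n
  induction n using Nat.strong_induction_on with
  | _ n ih =>
  intro Δ hn hΔ h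
  replace ih : ∀ Δ' : Multiset (Formula α), (∀ x ∈ Δ', x.Free p) → measure Δ' < measure Δ →
      Prov (Γ + Δ') φ → Prov (e ::ₘ Δ') a :=
    fun Δ' hΔ' hlt => ih _ (hn ▸ hlt) Δ' rfl hΔ'
  have hatom : ∀ q, p ≠ q → .atom q ∈ Γ → Prov {e} (.atom q) := fun q hq hm =>
    he.2.2 0 (by simp) _ (free_atom.2 hq) (.ax (by simp [hm]))
  rcases reduce_free_part hΓ hatom hΔ ih h with h' | hirr | ⟨q, b, Γ', hΓ', hq⟩
  · exact h'
  · rcases hirr.cases h with ⟨b, c, rfl⟩ | ⟨b, c, rfl⟩ | ⟨q, rfl, hq⟩ | ⟨b, c, rfl, hbc⟩ |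
      ⟨c, d, b, Θ, hΘ, hd⟩
    · exact absurd rfl (hand b c)
    · exact absurd rfl (himp b c)
    · rcases Multiset.mem_add.1 hq with hq | hq
      · exact ((hc _ hq).1 q rfl rfl).mono (by simp)
      · exact ((hφ Δ hΔ).1 q rfl hq).cons
    · exact ((hφ Δ hΔ).2 b c rfl hbc).cons
    · have hmem : .imp (.imp c d) b ∈ Γ + Δ := by rw [hΘ]; simp
      rcases Multiset.mem_add.1 hmem with hm | hm
      · obtain ⟨Γ', hΓ'⟩ := Multiset.exists_cons_of_mem hm
        have hΘ' : Θ = Γ' + Δ := by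
          rw [hΓ', Multiset.cons_add] at hΘ
          exact ((Multiset.cons_inj_right _).1 hΘ).symm
        refine ((hc _ hm).2.2 c d b Γ' rfl hΓ' Δ hΔ ?_ ?_).cons
        · rwa [Multiset.cons_add, Multiset.cons_add, ← hΘ']
        · rw [hΓ', Multiset.cons_add] at h
          rw [Multiset.cons_add]
          exact prov_cons_of_imp h
      · obtain ⟨Δ', rfl⟩ := Multiset.exists_cons_of_mem hm
        have hΘ' : Θ = Γ + Δ' := by
          rw [Multiset.add_cons] at hΘ
          exact ((Multiset.cons_inj_right _).1 hΘ).symm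
        have hf := hΔ _ hm
        simp only [free_imp] at hf
        have hΔ' : ∀ x ∈ Δ', x.Free p := fun x hx => hΔ x (by simp [hx])
        -- The left premise has the `p`-free goal `d`, so it is a matter for the post-interpolant;
        -- only the right premise keeps the goal `φ` and uses the induction hypothesis.
        refine prov_imp_imp_right (he.2.2 _ ?_ d hf.1.2 ?_) (ih _ ?_ measure_lt_of_imp ?_)
        · simpa [hf] using hΔ'
        · rwa [Multiset.add_cons, Multiset.add_cons, ← hΘ']
        · simpa [hf] using hΔ'
        · rw [Multiset.add_cons] at h ⊢
          exact prov_cons_of_imp h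
  · refine ((hc (.imp (.atom q) b) (by rw [hΓ']; simp)).2.1 q b Γ' rfl hΓ' Δ hΔ hq ?_).cons
    rw [hΓ', Multiset.cons_add] at h
    rw [Multiset.cons_add]
    exact prov_cons_of_imp h

theorem exists_isPre
    (ihE : ∀ Γ' : Multiset (Formula α), measure Γ' < measure Γ + φ.size → ∃ e, IsPost p Γ' e)
    (ihA : ∀ (Γ' : Multiset (Formula α)) ψ, measure Γ' + ψ.size < measure Γ + φ.size →
      ∃ a, IsPre p Γ' ψ a) : ∃ a, IsPre p Γ φ a := by
  by_cases hand : ∃ b c, φ = .and b c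
  · obtain ⟨b, c, rfl⟩ := hand
    have := size_and_left b c
    have := size_and_right b c
    have := b.size_pos
    have := c.size_pos
    obtain ⟨a₁, h₁⟩ := ihA Γ b (by omega)
    obtain ⟨a₂, h₂⟩ := ihA Γ c (by omega)
    exact ⟨_, isPre_and h₁ h₂⟩
  by_cases himp : ∃ b c, φ = .imp b c
  · obtain ⟨b, c, rfl⟩ := himp
    have := size_imp_left b c
    have := size_imp_right b c
    have := b.size_pos
    obtain ⟨a, h⟩ := ihA (b ::ₘ Γ) c (by simp; omega)
    exact ⟨_, isPre_imp h⟩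
  push Not at hand himp
  rcases reducible_or_irreducible Γ with hb | ⟨a, b, Γ', rfl⟩ | ⟨Γ', hr⟩ | hΓ
  · exact ⟨_, isPre_bot hb⟩
  · have := size_or_left a b
    have := size_or_right a b
    have := a.size_pos
    have := b.size_pos
    obtain ⟨a₁, h₁⟩ := ihA (a ::ₘ Γ') φ (by simp; omega)
    obtain ⟨a₂, h₂⟩ := ihA (b ::ₘ Γ') φ (by simp; omega)
    exact ⟨_, isPre_or h₁ h₂⟩
  · obtain ⟨a, ha⟩ := ihA Γ' φ (by have := hr.1; omega)
    exact ⟨a, hr.isPre ha⟩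
  -- The context is unchanged here: the call to `E(Γ)` is smaller only because the goal's size is
  -- dropped.
  · obtain ⟨e, he⟩ := ihE Γ (by have := φ.size_pos; omega)
    obtain ⟨a, ha, hΓa, hc⟩ := exists_disj (PreDisjunct p Γ φ) (fun _ _ _ => .of_prov) Γ
      fun x hx => exists_preDisjunct hΓ ihA hx
    obtain ⟨g, hg, hΓg, hφ⟩ := exists_goal_disjunct ihA
    refine ⟨.imp e (.or a g), isPre_of_preDisjunct hΓ he hand himp (by simp [ha, hg]) ?_
      (fun x hx => (hc x hx).of_prov (Prov.inl (.ax (by simp)))) fun Δ hΔ => ⟨?_, ?_⟩⟩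
    · exact Prov.head.orE (hΓa.congr_cons fun _ hx => .cons (.ax hx))
        (hΓg.congr_cons fun _ hx => .cons (.ax hx))
    · exact fun q hq hm => ((hφ Δ hΔ).1 q hq hm).inr
    · exact fun b c hq hm => ((hφ Δ hΔ).2 b c hq hm).inr

end Interpolants

/-! ### Simultaneous recursion and the main theorem -/

theorem exists_isPost_and_exists_isPre (p : α) (n : ℕ) :
    (∀ Γ : Multiset (Formula α), measure Γ = n → ∃ e, IsPost p Γ e) ∧
    ∀ (Γ : Multiset (Formula α)) φ, measure Γ + φ.size = n → ∃ a, IsPre p Γ φ a := by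
  induction n using Nat.strong_induction_on with
  | _ n ih =>
  constructor
  · rintro Γ rfl
    exact exists_isPost (fun Γ' h => (ih _ h).1 Γ' rfl) fun Γ' φ h => (ih _ h).2 Γ' φ rfl
  · rintro Γ φ rfl
    exact exists_isPre (fun Γ' h => (ih _ h).1 Γ' rfl) fun Γ' φ h => (ih _ h).2 Γ' φ rfl

theorem mem_logic_iff {φ : Formula α} : φ ∈ logic α ↔ Prov 0 φ := by
  simp [logic, Prov]

end IPC

theorem mainTheorem11 (α : Type*) : IPC.HasUniformInterpolation (IPC.logic α) := by
  intro φ p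
  -- With empty `Γ`, the side context `{ψ}` gives the pre-interpolant property; with `Γ = {φ}`, the
  -- empty side context gives the post-interpolant property.
  obtain ⟨a, ha, hφ, hmin⟩ := (IPC.exists_isPost_and_exists_isPre p _).2 0 φ rfl
  obtain ⟨e, he, hφe, hmax⟩ := (IPC.exists_isPost_and_exists_isPre p _).1 {φ} rfl
  simp only [IPC.mem_logic_iff, IPC.Prov.imp_iff]
  refine ⟨a, e, ha, he, hφ, fun ψ hψ h => ?_, hφe, fun ψ hψ h => ?_⟩
  · exact hmin (ψ ::ₘ 0) (by simpa using hψ) (by simpa using h)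
  · exact hmax 0 (by simp) ψ hψ (by simpa using h)
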